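/- Let $\mathcal C$ be an $\mathcal H_3$ fusion category, that is, a fusion category over $\mathbb C$ (a $\mathbb C$-linear abelian rigid semisimple monoidal category with finite-dimensional morphism spaces, finitely many simple objects up to isomorphism and simple unit object) with the following structure. * Its simple objects, up to isomorphism and without repetition, are $1,\alpha,\alpha^*,\rho,{}_\alpha\rho,{}_{\alpha^*}\rho$, where $1$ is the unit object. Their fusion is multiplicity free: $N_c^{ab}=\dim\hom(c,a\otimes b)\in\{0,1\}$. The fusion rules are those of $\mathcal H_3$: writing $\alpha^i$ and ${}_{\alpha^i}\rho$ with $i\in\mathbb Z/3$ (so $\alpha^0=1$, $\alpha^2=\alpha^*$, ${}_{\alpha^0}\rho=\rho$, ${}_{\alpha^2}\rho={}_{\alpha^*}\rho$), $\alpha^i\otimes\alpha^j=\alpha^{i+j}$, $\alpha^i\otimes{}_{\alpha^j}\rho={}_{\alpha^{i+j}}\rho$, ${}_{\alpha^i}\rho\otimes\alpha^j={}_{\alpha^{i-j}}\rho$ and ${}_{\alpha^i}\rho\otimes{}_{\alpha^j}\rho=\alpha^{i-j}+\rho+{}_\alpha\rho+{}_{\alpha^*}\rho$. * It has a pivotal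 structure for which $1,\alpha,\alpha^*$ have dimension $1$ and $\rho,{}_\alpha\rho,{}_{\alpha^*}\rho$ have dimension $\frac{3+\sqrt{13}}2$. * It has a trivalent vertex: a non-zero morphism in $\hom(1,\rho\otimes(\rho\otimes\rho))$ that is invariant under rotation by one click. For every triple of simple objects with $N_c^{ab}=1$ choose a basis vector $e_c^{ab}$ of $V_c^{ab}=\hom(c,a\otimes b)$, normalised at the unit by $l_1=l_\rho=1$ and $r_1=r_\rho=1$; that is, for $x\in\{1,\rho\}$ the left and right unitors send $e_x^{1x}$ and $e_x^{x1}$ to $\mathrm{id}_x$. The fusion trees $u\to k\otimes c\to(a\otimes b)\otimes c$ and $u\to a\otimes j\to a\otimes(b\otimes c)$ built from these vectors, with $k$ and $j$ running through the labels admitted by the fusion rules, are bases of $\hom(u,(a\otimes b)\otimes c)$ and $\hom(u,a\otimes(b\otimes c))$. Let $F_u^{abc}=\big((F_u^{abc})_{jk}\big)$ be the matrix in these bases of the isomorphism $\hom(u,(a\otimes b)\otimes c)\to\hom(u,a\otimes(b\otimes c))$ given by the associator. Let $a,b,c,u\in\{1,\rho\}$ with at least one of the four labels equal to $1$, and suppose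 that the fusion of $a$, $b$ and $c$ to $u$ is allowed, i.e. $N_k^{ab}N_u^{kc}\neq0$ for some $k$. Then both $\hom(u,(a\otimes b)\otimes c)$ and $\hom(u,a\otimes(b\otimes c))$ (the space $V_u^{abc}$ in its two bracketings) are one-dimensional, there is exactly one admissible $k$ and exactly one admissible $j$, and the $1\times1$ matrix $F_u^{abc}$ equals $1$. -/

import Mathlib

open CategoryTheory MonoidalCategory
open scoped CategoryTheory.Limits

noncomputable section

namespace H3Fusion

universe v u

/-! ## Fusion categories -/

attribute [local instance] Abelian.hasFiniteBiproducts

/-- A fusion category over `ℂ`: a `ℂ`-linear abelian rigid monoidal category (these are the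
instance arguments) with finite-dimensional morphism spaces in which every object is a finite
direct sum of simple objects, with finitely many simple objects up to isomorphism, and with
simple unit object. -/
class FusionCategory (C : Type u) [Category.{v} C] [Abelian C] [Linear ℂ C]
    [MonoidalCategory C] [MonoidalPreadditive C] [MonoidalLinear ℂ C] [RigidCategory C] :
    Prop where
  finiteDimensional_hom : ∀ X Y : C, FiniteDimensional ℂ (X ⟶ Y)
  semisimple : ∀ X : C, ∃ (n : ℕ) (S : Fin n → C),
    (∀ i, Simple (S i)) ∧ Nonempty (X ≅ ⨁ S)
  finite_simples : ∃ (n : ℕ) (S : Fin n → C), ∀ X : C, Simple X → ∃ i, Nonempty (X ≅ S i)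
  simple_unit : Simple (𝟙_ C)

/-! ## Pivotal structures, dimensions and rotation -/

/-- A pivotal structure: a monoidal natural isomorphism from the identity functor to the double
dual functor.  In `tensor` the object `(X ⊗ Y)ᘁᘁ` is identified with `Xᘁᘁ ⊗ Yᘁᘁ` by means of the
canonical isomorphisms `(X ⊗ Y)ᘁ ≅ Yᘁ ⊗ Xᘁ`. -/
structure PivotalStructure (C : Type u) [Category.{v} C] [MonoidalCategory C]
    [RigidCategory C] where
  iso : ∀ X : C, X ≅ (Xᘁ)ᘁ
  naturality : ∀ {X Y : C} (f : X ⟶ Y), f ≫ (iso Y).hom = (iso X).hom ≫ (fᘁ)ᘁ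
  tensor : ∀ X Y : C,
    (iso (X ⊗ Y)).hom ≫ ((rightDualTensorIso X Y).inv)ᘁ ≫ (rightDualTensorIso (Yᘁ) (Xᘁ)).hom
      = (iso X).hom ⊗ₘ (iso Y).hom

namespace PivotalStructure

variable {C : Type u} [Category.{v} C] [MonoidalCategory C] [RigidCategory C]

/-- The closed loop labelled `X`, an endomorphism of the unit object. -/
def loop (P : PivotalStructure C) (X : C) : 𝟙_ C ⟶ 𝟙_ C :=
  η_ X (Xᘁ) ≫ (P.iso X).hom ▷ (Xᘁ) ≫ ε_ (Xᘁ) ((Xᘁ)ᘁ)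

/-- The rotation of `hom(1, X ⊗ (X ⊗ X))` by one click: the first strand is bent around
the other two and becomes the last one. -/
def rotate (P : PivotalStructure C) {X : C} (f : 𝟙_ C ⟶ X ⊗ (X ⊗ X)) :
    𝟙_ C ⟶ X ⊗ (X ⊗ X) :=
  η_ (Xᘁ) ((Xᘁ)ᘁ) ≫ (Xᘁ) ◁ ((λ_ ((Xᘁ)ᘁ)).inv ≫ f ▷ ((Xᘁ)ᘁ) ≫ (α_ X (X ⊗ X) ((Xᘁ)ᘁ)).hom) ≫
    (α_ (Xᘁ) X ((X ⊗ X) ⊗ (Xᘁ)ᘁ)).inv ≫ ε_ X (Xᘁ) ▷ ((X ⊗ X) ⊗ (Xᘁ)ᘁ) ≫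
    (λ_ ((X ⊗ X) ⊗ (Xᘁ)ᘁ)).hom ≫ (X ⊗ X) ◁ (P.iso X).inv ≫ (α_ X X X).hom

end PivotalStructure

/-! ## The fusion rules of `H₃` -/

/-- The labels `1, α, α*, ρ, αρ, α*ρ` of the six simple objects. -/
inductive Label where
  | one | al | alStar | rho | alRho | alStarRho
  deriving DecidableEq

instance : Fintype Label where
  elems := {.one, .al, .alStar, .rho, .alRho, .alStarRho}
  complete x := by cases x <;> decide

open Label in
/-- The fusion table: `fuse a b` is the set of simple summands of `a ⊗ b`, all of which occur with
multiplicity one. -/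
def fuse : Label → Label → Finset Label
  | one, b => {b}
  | a, one => {a}
  | al, al => {alStar}
  | al, alStar => {one}
  | al, rho => {alRho}
  | al, alRho => {alStarRho}
  | al, alStarRho => {rho}
  | alStar, al => {one}
  | alStar, alStar => {al}
  | alStar, rho => {alStarRho}
  | alStar, alRho => {rho}
  | alStar, alStarRho => {alRho}
  | rho, al => {alStarRho}
  | rho, alStar => {alRho}
  | rho, rho => {one, rho, alRho, alStarRho}
  | rho, alRho => {alStar, rho, alRho, alStarRho}
  | rho, alStarRho => {al, rho, alRho, alStarRho}
  | alRho, al => {rho}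
  | alRho, alStar => {alStarRho}
  | alRho, rho => {al, rho, alRho, alStarRho}
  | alRho, alRho => {one, rho, alRho, alStarRho}
  | alRho, alStarRho => {alStar, rho, alRho, alStarRho}
  | alStarRho, al => {alRho}
  | alStarRho, alStar => {rho}
  | alStarRho, rho => {alStar, rho, alRho, alStarRho}
  | alStarRho, alRho => {al, rho, alRho, alStarRho}
  | alStarRho, alStarRho => {one, rho, alRho, alStarRho}

/-- The fusion coefficient `N_c^{ab}`. -/
def fusionCoeff (a b c : Label) : ℕ := if c ∈ fuse a b then 1 else 0

/-- The fusion of `a`, `b` and `c` to `u` is allowed by the fusion rules. -/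
def FusionAllowed (a b c u : Label) : Prop := ∃ k, k ∈ fuse a b ∧ u ∈ fuse k c

/-- The dimensions of the simple objects. -/
def simpleDim : Label → ℝ
  | .one | .al | .alStar => 1
  | .rho | .alRho | .alStarRho => (3 + √13) / 2

/-! ## The fusion category `H₃` -/

/-- A choice of the five non-trivial simple objects of an `H₃` category. -/
structure SimpleObjects (C : Type u) where
  al : C
  alStar : C
  rho : C
  alRho : C
  alStarRho : C

/-- The object with a given label; the label `1` is the unit object. -/
abbrev SimpleObjects.obj {C : Type u} [Category.{v} C] [MonoidalCategory C]
    (S : SimpleObjects C) : Label → C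
  | .one => 𝟙_ C
  | .al => S.al
  | .alStar => S.alStar
  | .rho => S.rho
  | .alRho => S.alRho
  | .alStarRho => S.alStarRho

/-- An `H₃` fusion category: the unit object and the five objects `α, α*, ρ, αρ, α*ρ` form a
complete list of pairwise non-isomorphic simple objects and satisfy the fusion rules
`dim hom(c, a ⊗ b) = N_c^{ab}`; there is a pivotal structure with dimensions `1` and
`(3 + √13) / 2`; and there is a trivalent vertex, a non-zero rotationally invariant morphism
`1 ⟶ ρ ⊗ (ρ ⊗ ρ)`. -/
structure H3Category (C : Type u) [Category.{v} C] [Abelian C] [Linear ℂ C]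
    [MonoidalCategory C] [MonoidalPreadditive C] [MonoidalLinear ℂ C] [RigidCategory C]
    [FusionCategory C] extends SimpleObjects C where
  simple_obj : ∀ a : Label, Simple (toSimpleObjects.obj a)
  not_iso : ∀ a b : Label, a ≠ b → IsEmpty (toSimpleObjects.obj a ≅ toSimpleObjects.obj b)
  exists_iso : ∀ X : C, Simple X → ∃ a : Label, Nonempty (X ≅ toSimpleObjects.obj a)
  finrank_hom : ∀ a b c : Label,
    Module.finrank ℂ
      (toSimpleObjects.obj c ⟶ toSimpleObjects.obj a ⊗ toSimpleObjects.obj b) = fusionCoeff a b c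
  pivotal : PivotalStructure C
  loop_eq : ∀ a : Label,
    pivotal.loop (toSimpleObjects.obj a) = ((simpleDim a : ℝ) : ℂ) • 𝟙 (𝟙_ C)
  vertex : 𝟙_ C ⟶ rho ⊗ (rho ⊗ rho)
  vertex_ne_zero : vertex ≠ 0
  rotate_vertex : pivotal.rotate vertex = vertex

namespace H3Category

variable {C : Type u} [Category.{v} C] [Abelian C] [Linear ℂ C]
    [MonoidalCategory C] [MonoidalPreadditive C] [MonoidalLinear ℂ C] [RigidCategory C]
    [FusionCategory C]

/-- The left unit constraint `l_x : hom(x, 1 ⊗ x) → hom(x, x)`. -/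
def l (H : H3Category C) (x : Label) :
    (H.obj x ⟶ H.obj .one ⊗ H.obj x) →ₗ[ℂ] (H.obj x ⟶ H.obj x) :=
  Linear.rightComp ℂ (H.obj x) (λ_ (H.obj x)).hom

/-- The right unit constraint `r_x : hom(x, x ⊗ 1) → hom(x, x)`. -/
def r (H : H3Category C) (x : Label) :
    (H.obj x ⟶ H.obj x ⊗ H.obj .one) →ₗ[ℂ] (H.obj x ⟶ H.obj x) :=
  Linear.rightComp ℂ (H.obj x) (ρ_ (H.obj x)).hom

/-- A choice of basis vectors of the fusion spaces `V_c^{ab} = hom(c, a ⊗ b)`: a non-zero vector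
in each of those that are one-dimensional (the remaining ones are zero). -/
structure Gauge (H : H3Category C) where
  vec : ∀ a b c : Label, H.obj c ⟶ H.obj a ⊗ H.obj b
  vec_ne_zero : ∀ a b c : Label, c ∈ fuse a b → vec a b c ≠ 0

/-- The unitor normalisation `l_1 = l_ρ = 1`, `r_1 = r_ρ = 1`: the left and right unit
constraints send the basis vectors of `V_x^{1x}` and `V_x^{x1}` to the identity of `x`, for
`x = 1` and `x = ρ`. -/
def Gauge.UnitNormalized {H : H3Category C} (e : H.Gauge) : Prop :=
  ∀ x : Label, x = .one ∨ x = .rho →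
    H.l x (e.vec .one x x) = 𝟙 (H.obj x) ∧ H.r x (e.vec x .one x) = 𝟙 (H.obj x)

/-- The admissible intermediate labels `k` of fusion trees `u → k ⊗ c → (a ⊗ b) ⊗ c`. -/
abbrev LeftLabel (a b c u : Label) : Type := {k : Label // k ∈ fuse a b ∧ u ∈ fuse k c}

/-- The admissible intermediate labels `j` of fusion trees `u → a ⊗ j → a ⊗ (b ⊗ c)`. -/
abbrev RightLabel (a b c u : Label) : Type := {j : Label // j ∈ fuse b c ∧ u ∈ fuse a j}

/-- The space `hom(u, (a ⊗ b) ⊗ c)`. -/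
abbrev LeftSpace (H : H3Category C) (a b c u : Label) : Type v :=
  H.obj u ⟶ (H.obj a ⊗ H.obj b) ⊗ H.obj c

/-- The space `hom(u, a ⊗ (b ⊗ c))`. -/
abbrev RightSpace (H : H3Category C) (a b c u : Label) : Type v :=
  H.obj u ⟶ H.obj a ⊗ (H.obj b ⊗ H.obj c)

namespace Gauge

variable {H : H3Category C} (e : H.Gauge)

/-- The fusion tree in `hom(u, (a ⊗ b) ⊗ c)` with intermediate label `k`. -/
def leftTree (a b c u k : Label) : H.LeftSpace a b c u :=
  e.vec k c u ≫ e.vec a b k ▷ H.obj c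

/-- The fusion tree in `hom(u, a ⊗ (b ⊗ c))` with intermediate label `j`. -/
def rightTree (a b c u j : Label) : H.RightSpace a b c u :=
  e.vec a j u ≫ H.obj a ◁ e.vec b c j

theorem exists_smul_vec (a b c : Label) (f : H.obj c ⟶ H.obj a ⊗ H.obj b) :
    (c ∈ fuse a b ∧ ∃ t : ℂ, f = t • e.vec a b c) ∨ f = 0 := by
  have := FusionCategory.finiteDimensional_hom (H.obj c) (H.obj a ⊗ H.obj b)
  have h := H.finrank_hom a b c
  by_cases hc : c ∈ fuse a b
  · left
    rw [fusionCoeff, if_pos hc] at h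
    obtain ⟨t, ht⟩ := (finrank_eq_one_iff_of_nonzero' _ (e.vec_ne_zero a b c hc)).1 h f
    exact ⟨hc, t, ht.symm⟩
  · right
    rw [fusionCoeff, if_neg hc] at h
    have := Module.finrank_zero_iff.1 h
    exact Subsingleton.elim _ _

theorem exists_projection (a b k : Label) (hk : k ∈ fuse a b) :
    ∃ p : H.obj a ⊗ H.obj b ⟶ H.obj k, e.vec a b k ≫ p = 𝟙 _ ∧
      ∀ k' : Label, k' ≠ k → e.vec a b k' ≫ p = 0 := by
  obtain ⟨n, S, hS, ⟨i⟩⟩ := FusionCategory.semisimple (H.obj a ⊗ H.obj b)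
  have hne : e.vec a b k ≫ i.hom ≠ 0 := fun h0 => e.vec_ne_zero a b k hk (by
    simpa using h0 =≫ i.inv)
  obtain ⟨m, hm⟩ : ∃ m, (e.vec a b k ≫ i.hom) ≫ Limits.biproduct.π S m ≠ 0 := by
    by_contra! hcon
    exact hne (Limits.biproduct.hom_ext _ _ fun m => by simpa using hcon m)
  have := H.simple_obj
  have := hS m
  have := isIso_of_hom_simple hm
  refine ⟨i.hom ≫ Limits.biproduct.π S m ≫
    inv ((e.vec a b k ≫ i.hom) ≫ Limits.biproduct.π S m), ?_, ?_⟩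
  · have h1 := IsIso.hom_inv_id ((e.vec a b k ≫ i.hom) ≫ Limits.biproduct.π S m)
    exact (by simp only [Category.assoc] : _ = _).trans h1
  · intro k' hk'
    by_contra hcon
    have hi := isIso_of_hom_simple hcon
    exact (H.not_iso k' k hk').false (@asIso _ _ _ _ _ hi)

theorem exists_resolution (a b : Label) :
    ∃ (n : ℕ) (x : Fin n → Label) (q : ∀ i, H.obj a ⊗ H.obj b ⟶ H.obj (x i)),
      (∀ i, x i ∈ fuse a b) ∧ 𝟙 (H.obj a ⊗ H.obj b) = ∑ i, q i ≫ e.vec a b (x i) := by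
  obtain ⟨n, S, hS, ⟨i⟩⟩ := FusionCategory.semisimple (H.obj a ⊗ H.obj b)
  choose x g using fun m => H.exists_iso (S m) (hS m)
  have key : ∀ m, x m ∈ fuse a b ∧ ∃ t : ℂ,
      (g m).some.inv ≫ Limits.biproduct.ι S m ≫ i.inv = t • e.vec a b (x m) := by
    intro m
    refine (e.exists_smul_vec a b (x m) _).resolve_right fun h0 => ?_
    have := hS m
    apply id_nonzero (S m)
    have h1 := congrArg (fun f => (g m).some.hom ≫ f ≫ i.hom ≫ Limits.biproduct.π S m) h0
    simpa using h1
  choose hx t ht using key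
  refine ⟨n, x, fun m => t m • (i.hom ≫ Limits.biproduct.π S m ≫ (g m).some.hom), hx, ?_⟩
  have h1 : ∀ m, (t m • (i.hom ≫ Limits.biproduct.π S m ≫ (g m).some.hom)) ≫ e.vec a b (x m)
      = i.hom ≫ (Limits.biproduct.π S m ≫ Limits.biproduct.ι S m) ≫ i.inv := by
    intro m
    rw [Linear.smul_comp, ← Linear.comp_smul, ← ht]
    simp
  simp only [h1]
  rw [← Preadditive.comp_sum, ← Preadditive.sum_comp, Limits.biproduct.total]
  simp

theorem leftTree_linearIndependent (a b c u : Label) :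
    LinearIndependent ℂ (fun k : LeftLabel a b c u => e.leftTree a b c u k) := by
  rw [Fintype.linearIndependent_iff]
  intro t ht k
  obtain ⟨p, hp, hp'⟩ := e.exists_projection a b k k.2.1
  have h1 := ht =≫ (p ▷ H.obj c)
  have h2 : ∀ k' : LeftLabel a b c u, k' ≠ k →
      (t k' • e.leftTree a b c u k') ≫ p ▷ H.obj c = 0 := by
    intro k' hk'
    rw [Linear.smul_comp, leftTree, Category.assoc, ← MonoidalCategory.comp_whiskerRight,
      hp' k' (fun h => hk' (Subtype.ext h))]
    simp
  rw [Preadditive.sum_comp, Finset.sum_eq_single k (fun k' _ hk' => h2 k' hk') (by simp),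
    Linear.smul_comp, leftTree, Category.assoc, ← MonoidalCategory.comp_whiskerRight, hp] at h1
  simp only [MonoidalCategory.id_whiskerRight, Category.comp_id, Limits.zero_comp] at h1
  exact (smul_eq_zero.1 h1).resolve_right (e.vec_ne_zero _ _ _ k.2.2)

theorem rightTree_linearIndependent (a b c u : Label) :
    LinearIndependent ℂ (fun j : RightLabel a b c u => e.rightTree a b c u j) := by
  rw [Fintype.linearIndependent_iff]
  intro t ht k
  obtain ⟨p, hp, hp'⟩ := e.exists_projection b c k k.2.1
  have h1 := ht =≫ (H.obj a ◁ p)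
  have h2 : ∀ k' : RightLabel a b c u, k' ≠ k →
      (t k' • e.rightTree a b c u k') ≫ H.obj a ◁ p = 0 := by
    intro k' hk'
    rw [Linear.smul_comp, rightTree, Category.assoc, ← MonoidalCategory.whiskerLeft_comp,
      hp' k' (fun h => hk' (Subtype.ext h))]
    simp
  rw [Preadditive.sum_comp, Finset.sum_eq_single k (fun k' _ hk' => h2 k' hk') (by simp),
    Linear.smul_comp, rightTree, Category.assoc, ← MonoidalCategory.whiskerLeft_comp, hp] at h1
  simp only [MonoidalCategory.whiskerLeft_id, Category.comp_id, Limits.zero_comp] at h1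
  exact (smul_eq_zero.1 h1).resolve_right (e.vec_ne_zero _ _ _ k.2.2)

theorem leftTree_span (a b c u : Label) :
    ⊤ ≤ Submodule.span ℂ (Set.range fun k : LeftLabel a b c u => e.leftTree a b c u k) := by
  rintro f -
  obtain ⟨n, x, q, hx, hq⟩ := e.exists_resolution a b
  have hf : f = ∑ i, (f ≫ q i ▷ H.obj c) ≫ e.vec a b (x i) ▷ H.obj c := by
    simp only [Category.assoc, ← MonoidalCategory.comp_whiskerRight]
    rw [← Preadditive.comp_sum, ← sum_whiskerRight, ← hq]
    simp
  rw [hf]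
  refine Submodule.sum_mem _ fun i _ => ?_
  rcases e.exists_smul_vec (x i) c u (f ≫ q i ▷ H.obj c) with ⟨hu, t, ht⟩ | h0
  · rw [ht, Linear.smul_comp]
    exact Submodule.smul_mem _ _ (Submodule.subset_span ⟨⟨x i, hx i, hu⟩, rfl⟩)
  · rw [h0, Limits.zero_comp]
    exact Submodule.zero_mem _

theorem rightTree_span (a b c u : Label) :
    ⊤ ≤ Submodule.span ℂ (Set.range fun j : RightLabel a b c u => e.rightTree a b c u j) := by
  rintro f -
  obtain ⟨n, x, q, hx, hq⟩ := e.exists_resolution b c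
  have hf : f = ∑ i, (f ≫ H.obj a ◁ q i) ≫ H.obj a ◁ e.vec b c (x i) := by
    simp only [Category.assoc, ← MonoidalCategory.whiskerLeft_comp]
    rw [← Preadditive.comp_sum, ← whiskerLeft_sum, ← hq]
    simp
  rw [hf]
  refine Submodule.sum_mem _ fun i _ => ?_
  rcases e.exists_smul_vec a (x i) u (f ≫ H.obj a ◁ q i) with ⟨hu, t, ht⟩ | h0
  · rw [ht, Linear.smul_comp]
    exact Submodule.smul_mem _ _ (Submodule.subset_span ⟨⟨x i, hx i, hu⟩, rfl⟩)
  · rw [h0, Limits.zero_comp]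
    exact Submodule.zero_mem _

/-- The basis of `hom(u, (a ⊗ b) ⊗ c)` that consists of the fusion trees. -/
def leftBasis (a b c u : Label) : Module.Basis (LeftLabel a b c u) ℂ (H.LeftSpace a b c u) :=
  Module.Basis.mk (e.leftTree_linearIndependent a b c u) (e.leftTree_span a b c u)

/-- The basis of `hom(u, a ⊗ (b ⊗ c))` that consists of the fusion trees. -/
def rightBasis (a b c u : Label) : Module.Basis (RightLabel a b c u) ℂ (H.RightSpace a b c u) :=
  Module.Basis.mk (e.rightTree_linearIndependent a b c u) (e.rightTree_span a b c u)

end Gauge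

/-- The isomorphism `F_u^{abc} : hom(u, (a ⊗ b) ⊗ c) → hom(u, a ⊗ (b ⊗ c))`, composition with
the associator. -/
def FMap (H : H3Category C) (a b c u : Label) :
    H.LeftSpace a b c u →ₗ[ℂ] H.RightSpace a b c u :=
  Linear.rightComp ℂ (H.obj u) (α_ (H.obj a) (H.obj b) (H.obj c)).hom

/-- The `F`-matrix: the image under `F_u^{abc}` of the left tree `k` is
`∑ j, (FMatrix a b c u) j k` times the right tree `j`. -/
def Gauge.FMatrix {H : H3Category C} (e : H.Gauge) (a b c u : Label) :
    Matrix (RightLabel a b c u) (LeftLabel a b c u) ℂ :=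
  LinearMap.toMatrix (e.leftBasis a b c u) (e.rightBasis a b c u) (H.FMap a b c u)

end H3Category

end H3Fusion

end

/-! If `a`, `b` or `c` is `1`, the unit normalisation makes the basis vectors involved inverse
unitors, and coherence and naturality identify the two trees.

The remaining case is `a = b = c = ρ`, `u = 1`. Put `η = e_1^{ρρ}` and `y = e_ρ^{ρρ}`. Since `η` is
non-zero and `ρ` is simple, `η` is the coevaluation of a pairing of `ρ` with itself
(`FusionCategory.exists_exactPairing`). Bending the first strand with this pairing turns the right
tree `R = η ≫ ρ ◁ y` into the left tree followed by the associator (`selfRotate_rightTree`), so the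
claim is that `R` is fixed by `selfRotate`. The space of `R` is one-dimensional and contains the
trivalent vertex, so `R` is fixed by the pivotal rotation.

The two rotations differ by the scalar `t` that compares the pivotal structure with the isomorphism
`ρ ≅ ρᘁᘁ` of the pairing, a Frobenius–Schur indicator. Monoidality of the pivotal structure gives
`t² = 1` (`PivotalStructure.indicator_sq`). The vertex rules out `t = -1`: sliding two copies of the
bent vertex past each other gives `t s = s`, where `y ≫ bendLeft y = s • 𝟙` and `s ≠ 0`
(`PivotalStructure.selfRotate_eq_self`). -/

namespace H3Fusion

universe v u


/-! ### Self-pairings and the isomorphism with the double dual -/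

section SelfPairing

open ExactPairing HasRightDual

variable {C : Type u} [Category.{v} C] [MonoidalCategory C]

theorem whiskerLeft_coevaluation_injective {X Y Z : C} [ExactPairing X Y] {f g : Y ⟶ Z}
    (h : η_ X Y ≫ X ◁ f = η_ X Y ≫ X ◁ g) : f = g := by
  have := congrArg (tensorLeftHomEquiv _ X Y Z).symm h
  simpa using this

theorem rightAdjointMate_eq {X Y : C} [HasRightDual X] [HasRightDual Y] {f : X ⟶ Y}
    {k : Yᘁ ⟶ Xᘁ} (h : η_ Y Yᘁ ≫ Y ◁ k = η_ X Xᘁ ≫ f ▷ Xᘁ) : fᘁ = k :=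
  whiskerLeft_coevaluation_injective ((coevaluation_comp_rightAdjointMate f).trans h.symm)

/-- `rightDualIso` is the mate of the identity of `X` with respect to two choices of dual. -/
theorem coevaluation_comp_rightDualIso {X Y₁ Y₂ : C} (p₁ : ExactPairing X Y₁)
    (p₂ : ExactPairing X Y₂) :
    η_ X Y₁ ≫ X ◁ (rightDualIso p₁ p₂).hom = η_ X Y₂ := by
  have := @coevaluation_comp_rightAdjointMate C _ _ X X ⟨Y₂⟩ ⟨Y₁⟩ (𝟙 X)
  exact this.trans (by rw [id_whiskerRight, Category.comp_id]; rfl)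

theorem rightDualIso_comp_evaluation {X Y₁ Y₂ : C} (p₁ : ExactPairing X Y₁)
    (p₂ : ExactPairing X Y₂) :
    (rightDualIso p₁ p₂).hom ▷ X ≫ ε_ X Y₂ = ε_ X Y₁ := by
  have := @rightAdjointMate_comp_evaluation C _ _ X X ⟨Y₂⟩ ⟨Y₁⟩ (𝟙 X)
  exact this.trans (by rw [whiskerLeft_id, Category.id_comp]; rfl)

/-- The isomorphism between the right dual of an object and the object itself that is given by a
pairing of the object with itself. -/
def selfDualIso (X : C) [p : HasRightDual X] [q : ExactPairing X X] : Xᘁ ≅ X :=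
  rightDualIso p.exact q

theorem coevaluation_selfDualIso (X : C) [HasRightDual X] [ExactPairing X X] :
    η_ X Xᘁ ≫ X ◁ (selfDualIso X).hom = η_ X X :=
  coevaluation_comp_rightDualIso _ _

theorem coevaluation_selfDualIso_inv (X : C) [HasRightDual X] [ExactPairing X X] :
    η_ X X ≫ X ◁ (selfDualIso X).inv = η_ X Xᘁ := by
  rw [← coevaluation_selfDualIso]; simp

theorem selfDualIso_evaluation (X : C) [HasRightDual X] [ExactPairing X X] :
    (selfDualIso X).hom ▷ X ≫ ε_ X X = ε_ X Xᘁ :=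
  rightDualIso_comp_evaluation _ _

theorem selfDualIso_inv_evaluation (X : C) [HasRightDual X] [ExactPairing X X] :
    (selfDualIso X).inv ▷ X ≫ ε_ X Xᘁ = ε_ X X := by
  rw [← selfDualIso_evaluation]; simp

/-- The isomorphism of an object with its double dual that is given by a pairing of the object
with itself. -/
def doubleDualIso (X : C) [HasRightDual X] [HasRightDual Xᘁ] [ExactPairing X X] : X ≅ (Xᘁ)ᘁ where
  hom := (selfDualIso X).inv ≫ (selfDualIso X).homᘁ
  inv := (selfDualIso X).invᘁ ≫ (selfDualIso X).hom
  hom_inv_id := by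
    rw [Category.assoc, ← comp_rightAdjointMate_assoc]; simp
  inv_hom_id := by
    rw [Category.assoc, Iso.hom_inv_id_assoc, ← comp_rightAdjointMate]; simp

theorem coevaluation_doubleDualIso (X : C) [HasRightDual X] [HasRightDual Xᘁ]
    [ExactPairing X X] :
    η_ X X ≫ ((selfDualIso X).inv ⊗ₘ (doubleDualIso X).hom) = η_ Xᘁ ((Xᘁ)ᘁ) := by
  have h := coevaluation_comp_rightAdjointMate (selfDualIso X).hom
  rw [doubleDualIso, tensorHom_def', MonoidalCategory.whiskerLeft_comp, Category.assoc,
    reassoc_of% (coevaluation_selfDualIso_inv _), reassoc_of% h]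
  simp

theorem doubleDualIso_evaluation (X : C) [HasRightDual X] [HasRightDual Xᘁ]
    [ExactPairing X X] :
    (doubleDualIso X).hom ▷ Xᘁ ≫ ε_ Xᘁ ((Xᘁ)ᘁ) = X ◁ (selfDualIso X).hom ≫ ε_ X X := by
  have h := rightAdjointMate_comp_evaluation (selfDualIso X).hom
  rw [doubleDualIso, MonoidalCategory.comp_whiskerRight, Category.assoc, h,
    ← selfDualIso_inv_evaluation, whisker_exchange_assoc]

/-- This loop will fix the scalar between a pivotal structure and `doubleDualIso`. -/
theorem loop_doubleDualIso (X : C) [HasRightDual X] [HasRightDual Xᘁ] [ExactPairing X X] :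
    η_ X Xᘁ ≫ (doubleDualIso X).hom ▷ Xᘁ ≫ ε_ Xᘁ ((Xᘁ)ᘁ) = η_ X X ≫ ε_ X X := by
  rw [doubleDualIso_evaluation, reassoc_of% (coevaluation_selfDualIso _)]

theorem rightAdjointMate_selfDualIso {X Y : C} [HasRightDual X] [HasRightDual Y]
    [ExactPairing X X] [ExactPairing Y Y] {f : X ⟶ Y} {k : Y ⟶ X}
    (h : η_ Y Y ≫ Y ◁ k = η_ X X ≫ f ▷ X) :
    fᘁ ≫ (selfDualIso X).hom = (selfDualIso Y).hom ≫ k := by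
  rw [← Iso.eq_comp_inv, Category.assoc]
  apply rightAdjointMate_eq
  rw [MonoidalCategory.whiskerLeft_comp, MonoidalCategory.whiskerLeft_comp,
    reassoc_of% (coevaluation_selfDualIso _), reassoc_of% h, ← whisker_exchange,
    reassoc_of% (coevaluation_selfDualIso_inv _)]

/-- Under the self-dualities, `fᘁ` becomes `k` and `kᘁ` becomes `f`, so taking mates twice returns
`f`. The pairings need not be symmetric, so left and right transposes of `f` may differ; the two
hypotheses say that `k` is both. -/
theorem doubleDualIso_naturality {X Y : C} [HasRightDual X] [HasRightDual Y]
    [HasRightDual Xᘁ] [HasRightDual Yᘁ]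
    [ExactPairing X X] [ExactPairing Y Y] {f : X ⟶ Y} {k : Y ⟶ X}
    (h : η_ Y Y ≫ Y ◁ k = η_ X X ≫ f ▷ X) (h' : η_ X X ≫ X ◁ f = η_ Y Y ≫ k ▷ Y) :
    f ≫ (doubleDualIso Y).hom = (doubleDualIso X).hom ≫ (fᘁ)ᘁ := by
  have h1 := rightAdjointMate_selfDualIso h
  have h2 := rightAdjointMate_selfDualIso h'
  have h3 : (selfDualIso X).homᘁ ≫ (fᘁ)ᘁ = kᘁ ≫ (selfDualIso Y).homᘁ := by
    rw [← comp_rightAdjointMate, h1, comp_rightAdjointMate]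
  dsimp only [doubleDualIso]
  rw [Category.assoc, h3, Iso.eq_inv_comp, ← reassoc_of% h2]
  simp

theorem rightAdjointMate_tensorHom {X₁ X₂ Y₁ Y₂ : C} [HasRightDual X₁] [HasRightDual X₂]
    [HasRightDual Y₁] [HasRightDual Y₂] (f : X₁ ⟶ Y₁) (g : X₂ ⟶ Y₂) :
    @rightAdjointMate C _ _ _ _ hasRightDualTensor hasRightDualTensor (f ⊗ₘ g) = gᘁ ⊗ₘ fᘁ := by
  refine @rightAdjointMate_eq C _ _ _ _ hasRightDualTensor hasRightDualTensor _ _ ?_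
  change η_ (Y₁ ⊗ Y₂) (Y₂ᘁ ⊗ Y₁ᘁ) ≫ (Y₁ ⊗ Y₂) ◁ (gᘁ ⊗ₘ fᘁ) =
    η_ (X₁ ⊗ X₂) (X₂ᘁ ⊗ X₁ᘁ) ≫ (f ⊗ₘ g) ▷ (X₂ᘁ ⊗ X₁ᘁ)
  rw [tensor_coevaluation, tensor_coevaluation]
  calc
    _ = η_ Y₁ Y₁ᘁ ⊗≫ Y₁ ◁ (η_ Y₂ Y₂ᘁ ▷ Y₁ᘁ ≫ (Y₂ ⊗ Y₂ᘁ) ◁ fᘁ) ⊗≫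
        Y₁ ◁ (Y₂ ◁ gᘁ) ▷ X₁ᘁ ⊗≫ 𝟙 _ := by
      rw [tensorHom_def']; monoidal
    _ = (η_ Y₁ Y₁ᘁ ≫ Y₁ ◁ fᘁ) ⊗≫ Y₁ ◁ (η_ Y₂ Y₂ᘁ ≫ Y₂ ◁ gᘁ) ▷ X₁ᘁ ⊗≫ 𝟙 _ := by
      rw [← whisker_exchange]; monoidal
    _ = η_ X₁ X₁ᘁ ⊗≫ (f ▷ (𝟙_ C) ≫ Y₁ ◁ η_ X₂ X₂ᘁ) ▷ X₁ᘁ ⊗≫ Y₁ ◁ (g ▷ X₂ᘁ) ▷ X₁ᘁ ⊗≫ 𝟙 _ := by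
      rw [coevaluation_comp_rightAdjointMate, coevaluation_comp_rightAdjointMate]; monoidal
    _ = _ := by
      rw [← whisker_exchange, MonoidalCategory.tensorHom_def]; monoidal

/-- Both sides are the mate of `f ⊗ₘ g`, computed with the chosen dual of `Y₁ ⊗ Y₂` and the tensor
dual of `X₁ ⊗ X₂`. -/
theorem rightDualTensorIso_naturality {X₁ X₂ Y₁ Y₂ : C} [HasRightDual X₁] [HasRightDual X₂]
    [HasRightDual Y₁] [HasRightDual Y₂] [HasRightDual (X₁ ⊗ X₂)] [HasRightDual (Y₁ ⊗ Y₂)]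
    (f : X₁ ⟶ Y₁) (g : X₂ ⟶ Y₂) :
    (f ⊗ₘ g)ᘁ ≫ (rightDualTensorIso X₁ X₂).hom =
      (rightDualTensorIso Y₁ Y₂).hom ≫ (gᘁ ⊗ₘ fᘁ) := by
  rw [← rightAdjointMate_tensorHom]
  dsimp only [rightDualTensorIso, rightDualIso]
  erw [← @comp_rightAdjointMate C _ _ _ _ _ hasRightDualTensor _ _ (𝟙 (X₁ ⊗ X₂)) (f ⊗ₘ g),
    ← @comp_rightAdjointMate C _ _ _ _ _ hasRightDualTensor hasRightDualTensor _ (f ⊗ₘ g)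
      (𝟙 (Y₁ ⊗ Y₂))]
  rw [Category.id_comp, Category.comp_id]

theorem selfDualIso_tensor (X : C) [HasRightDual X] [HasRightDual (X ⊗ X)] [ExactPairing X X] :
    (selfDualIso (X ⊗ X)).hom =
      (rightDualTensorIso X X).hom ≫ ((selfDualIso X).hom ⊗ₘ (selfDualIso X).hom) := by
  apply whiskerLeft_coevaluation_injective (X := X ⊗ X)
  rw [coevaluation_selfDualIso, MonoidalCategory.whiskerLeft_comp, rightDualTensorIso,
    reassoc_of% (coevaluation_comp_rightDualIso (X := X ⊗ X) HasRightDual.exact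
      (ExactPairing.tensor (Y₁ := Xᘁ) (Y₂ := Xᘁ))), tensor_coevaluation, tensor_coevaluation]
  symm
  calc
    _ = η_ X Xᘁ ⊗≫ X ◁ (η_ X Xᘁ ▷ Xᘁ ≫ (X ⊗ Xᘁ) ◁ (selfDualIso X).hom) ⊗≫
        X ◁ (X ◁ (selfDualIso X).hom) ▷ X ⊗≫ 𝟙 _ := by
      rw [tensorHom_def']; monoidal
    _ = (η_ X Xᘁ ≫ X ◁ (selfDualIso X).hom) ⊗≫
        X ◁ (η_ X Xᘁ ≫ X ◁ (selfDualIso X).hom) ▷ X ⊗≫ 𝟙 _ := by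
      rw [← whisker_exchange]; monoidal
    _ = _ := by
      rw [coevaluation_selfDualIso]; monoidal

/-- With the nested pairing on `X ⊗ X`, the isomorphism with the double dual satisfies the
monoidality condition of a pivotal structure. -/
theorem doubleDualIso_tensor (X : C) [HasRightDual X] [HasRightDual Xᘁ] [HasRightDual (X ⊗ X)]
    [HasRightDual (X ⊗ X)ᘁ] [HasRightDual (Xᘁ ⊗ Xᘁ)] [ExactPairing X X] :
    (doubleDualIso (X ⊗ X)).hom ≫ (rightDualTensorIso X X).invᘁ ≫ (rightDualTensorIso Xᘁ Xᘁ).hom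
      = (doubleDualIso X).hom ⊗ₘ (doubleDualIso X).hom := by
  have h1 : (selfDualIso (X ⊗ X)).homᘁ ≫ (rightDualTensorIso X X).invᘁ =
      ((selfDualIso X).hom ⊗ₘ (selfDualIso X).hom)ᘁ := by
    rw [← comp_rightAdjointMate, selfDualIso_tensor, Iso.inv_hom_id_assoc]
  dsimp only [doubleDualIso]
  rw [Category.assoc, reassoc_of% h1, rightDualTensorIso_naturality, Iso.inv_comp_eq,
    selfDualIso_tensor]
  simp

end SelfPairing


/-! ### Rotation of trivalent vertices -/

section Rotation

open ExactPairing HasRightDual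

variable {C : Type u} [Category.{v} C] [MonoidalCategory C]

/-- Rotation by one click of an invariant vector, bending the first strand by means of a pairing
of `X` with itself. -/
def selfRotate {X : C} [ExactPairing X X] (f : 𝟙_ C ⟶ X ⊗ (X ⊗ X)) : 𝟙_ C ⟶ X ⊗ (X ⊗ X) :=
  η_ X X ≫ X ◁ ((λ_ X).inv ≫ f ▷ X ≫ (α_ X (X ⊗ X) X).hom) ≫ (α_ X X ((X ⊗ X) ⊗ X)).inv ≫
    ε_ X X ▷ ((X ⊗ X) ⊗ X) ≫ (λ_ ((X ⊗ X) ⊗ X)).hom ≫ (α_ X X X).hom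

/-- The bent strand is a zigzag of `η` and `ε`; straightening it moves `y` to the other leg of `η`.
-/
theorem selfRotate_rightTree {X : C} [ExactPairing X X] (y : X ⟶ X ⊗ X) :
    selfRotate (η_ X X ≫ X ◁ y) = η_ X X ≫ y ▷ X ≫ (α_ X X X).hom := by
  dsimp only [selfRotate]
  calc
    _ = η_ X X ⊗≫ (X ◁ η_ X X) ▷ X ⊗≫ ((X ⊗ X) ◁ y ≫ ε_ X X ▷ (X ⊗ X)) ▷ X ⊗≫ 𝟙 _ := by
      monoidal
    _ = η_ X X ⊗≫ (X ◁ η_ X X ⊗≫ ε_ X X ▷ X) ▷ X ⊗≫ y ▷ X ⊗≫ 𝟙 _ := by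
      rw [whisker_exchange]; monoidal
    _ = _ := by
      rw [coevaluation_evaluation'']; monoidal

/-- The map `X ⊗ X ⟶ X` obtained from `y : X ⟶ X ⊗ X` by bending down the left strand. -/
def bendLeft {X : C} [ExactPairing X X] (y : X ⟶ X ⊗ X) : X ⊗ X ⟶ X :=
  X ◁ y ≫ (α_ X X X).inv ≫ ε_ X X ▷ X ≫ (λ_ X).hom

theorem coevaluation_whiskerLeft_bendLeft {X : C} [ExactPairing X X] (y : X ⟶ X ⊗ X) :
    η_ (X ⊗ X) (X ⊗ X) ≫ (X ⊗ X) ◁ bendLeft y = η_ X X ≫ X ◁ y ≫ (α_ X X X).inv := by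
  rw [tensor_coevaluation, bendLeft]
  calc
    _ = η_ X X ⊗≫ X ◁ (η_ X X ▷ X ≫ (X ⊗ X) ◁ y) ⊗≫ X ◁ X ◁ ε_ X X ▷ X ⊗≫ 𝟙 _ := by
      monoidal
    _ = η_ X X ⊗≫ X ◁ y ⊗≫ X ◁ (η_ X X ▷ X ⊗≫ X ◁ ε_ X X) ▷ X ⊗≫ 𝟙 _ := by
      rw [← whisker_exchange]; monoidal
    _ = _ := by
      rw [evaluation_coevaluation'']; monoidal

theorem coevaluation_bendLeft_whiskerRight {X : C} [ExactPairing X X] (y : X ⟶ X ⊗ X) :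
    η_ (X ⊗ X) (X ⊗ X) ≫ bendLeft y ▷ (X ⊗ X) =
      selfRotate (η_ X X ≫ y ▷ X ≫ (α_ X X X).hom) := by
  rw [tensor_coevaluation, bendLeft, selfRotate]
  monoidal

/-- Both sides are `η_ (X ⊗ X) (X ⊗ X)` with `bendLeft y` applied to each leg; they differ only in
which leg is treated first. -/
theorem selfRotate_selfRotate_bendLeft {X : C} [ExactPairing X X] (y : X ⟶ X ⊗ X) :
    selfRotate (selfRotate (η_ X X ≫ X ◁ y)) ≫ X ◁ bendLeft y =
      η_ X X ≫ X ◁ y ≫ (α_ X X X).inv ≫ bendLeft y ▷ X := by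
  have h1 := coevaluation_whiskerLeft_bendLeft y =≫ bendLeft y ▷ X
  rw [Category.assoc, whisker_exchange, ← Category.assoc,
    coevaluation_bendLeft_whiskerRight, ← selfRotate_rightTree] at h1
  simpa using h1

/-- The self-duality of `X` replaces the strands `Xᘁ` and `(Xᘁ)ᘁ` by `X`. The only trace of the
pivotal structure is the comparison on the last strand. -/
theorem PivotalStructure.rotate_eq [RigidCategory C] (P : PivotalStructure C) {X : C}
    [ExactPairing X X] (f : 𝟙_ C ⟶ X ⊗ (X ⊗ X)) :
    P.rotate f = selfRotate f ≫ X ◁ X ◁ ((doubleDualIso X).hom ≫ (P.iso X).inv) := by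
  have h : η_ (Xᘁ) ((Xᘁ)ᘁ) = _ := (coevaluation_doubleDualIso X).symm
  rw [PivotalStructure.rotate, h, selfRotate, ← selfDualIso_inv_evaluation]
  set i := (selfDualIso X).inv
  set t := (doubleDualIso X).hom
  set p := (P.iso X).inv
  calc
    _ = η_ X X ≫ i ▷ X ⊗≫ Xᘁ ◁ ((𝟙_ C) ◁ t ≫ f ▷ ((Xᘁ)ᘁ)) ⊗≫
        ε_ X Xᘁ ▷ (X ⊗ X) ▷ ((Xᘁ)ᘁ) ⊗≫ X ◁ X ◁ p := by
      rw [MonoidalCategory.tensorHom_def]; monoidal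
    _ = η_ X X ⊗≫ (i ▷ (𝟙_ C) ≫ Xᘁ ◁ f) ▷ X ⊗≫ ((Xᘁ ⊗ X) ◁ ((X ⊗ X) ◁ t) ≫
        ε_ X Xᘁ ▷ ((X ⊗ X) ⊗ (Xᘁ)ᘁ)) ⊗≫ X ◁ X ◁ p := by
      rw [whisker_exchange]; monoidal
    _ = _ := by
      rw [whisker_exchange, ← whisker_exchange i f]; monoidal

end Rotation


/-! ### The Frobenius–Schur indicator -/

section Indicator

open ExactPairing HasRightDual

variable {C : Type u} [Category.{v} C] [MonoidalCategory C]

theorem tensor_coevaluation_evaluation (X : C) [ExactPairing X X] :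
    η_ (X ⊗ X) (X ⊗ X) ≫ (X ⊗ X) ◁ ε_ X X = η_ (𝟙_ C) (𝟙_ C) ≫ η_ X X ▷ 𝟙_ C := by
  rw [tensor_coevaluation]
  calc
    _ = η_ X X ⊗≫ X ◁ (η_ X X ▷ X ⊗≫ X ◁ ε_ X X) ⊗≫ 𝟙 _ := by monoidal
    _ = η_ X X ⊗≫ 𝟙 _ := by rw [evaluation_coevaluation'']; monoidal
    _ = (ρ_ (𝟙_ C)).inv ≫ η_ X X ▷ 𝟙_ C := by monoidal
    -- The pairing of the unit with itself has coevaluation `(ρ_ (𝟙_ C)).inv` by definition.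
    _ = _ := rfl

theorem coevaluation_tensor_evaluation (X : C) [ExactPairing X X] :
    η_ (𝟙_ C) (𝟙_ C) ≫ 𝟙_ C ◁ η_ X X = η_ (X ⊗ X) (X ⊗ X) ≫ ε_ X X ▷ (X ⊗ X) := by
  rw [tensor_coevaluation]
  symm
  calc
    _ = η_ X X ⊗≫ (X ◁ η_ X X ⊗≫ ε_ X X ▷ X) ▷ X ⊗≫ 𝟙 _ := by monoidal
    _ = η_ X X ⊗≫ 𝟙 _ := by rw [coevaluation_evaluation'']; monoidal
    _ = (ρ_ (𝟙_ C)).inv ≫ 𝟙_ C ◁ η_ X X := by monoidal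
    _ = _ := rfl

variable [Preadditive C] [Linear ℂ C]

theorem selfRotate_smul [MonoidalPreadditive C] [MonoidalLinear ℂ C] {X : C} [ExactPairing X X] (t : ℂ) (f : 𝟙_ C ⟶ X ⊗ (X ⊗ X)) :
    selfRotate (t • f) = t • selfRotate f := by
  simp [selfRotate]

variable [MonoidalPreadditive C] [MonoidalLinear ℂ C] [RigidCategory C]

theorem PivotalStructure.iso_eq_doubleDualIso (P : PivotalStructure C) {U : C} [ExactPairing U U]
    (h : P.loop U = η_ U U ≫ ε_ U U) (h0 : P.loop U ≠ 0)
    (hU : ∀ f : U ⟶ U, ∃ t : ℂ, f = t • 𝟙 U) :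
    (P.iso U).hom = (doubleDualIso U).hom := by
  obtain ⟨t, ht⟩ := hU ((P.iso U).hom ≫ (doubleDualIso U).inv)
  rw [Iso.comp_inv_eq, Linear.smul_comp, Category.id_comp] at ht
  have h2 : P.loop U = t • P.loop U := by
    conv_rhs => rw [h, ← loop_doubleDualIso]
    rw [PivotalStructure.loop, ht, MonoidalLinear.smul_whiskerRight, Linear.smul_comp,
      Linear.comp_smul]
  have h3 : (t - 1) • P.loop U = 0 := by rw [sub_smul, ← h2, one_smul, sub_self]
  rw [ht, sub_eq_zero.1 ((smul_eq_zero.1 h3).resolve_right h0), one_smul]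

/-- Naturality along `c` carries the comparison scalar `1` of `U` to that of `X ⊗ X`, which is `t *
t` by monoidality. -/
theorem PivotalStructure.indicator_sq (P : PivotalStructure C) {U X : C} [ExactPairing U U]
    [ExactPairing X X] (hU : (P.iso U).hom = (doubleDualIso U).hom) {t : ℂ}
    (ht : (P.iso X).hom = t • (doubleDualIso X).hom) {c : U ⟶ X ⊗ X} {k : X ⊗ X ⟶ U}
    (hc : c ≠ 0)
    (h : η_ (X ⊗ X) (X ⊗ X) ≫ (X ⊗ X) ◁ k = η_ U U ≫ c ▷ U)
    (h' : η_ U U ≫ U ◁ c = η_ (X ⊗ X) (X ⊗ X) ≫ k ▷ (X ⊗ X)) : t * t = 1 := by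
  have hn := P.naturality c
  rw [hU, ← doubleDualIso_naturality h h'] at hn
  have h2 : (c ≫ (P.iso (X ⊗ X)).hom) ≫
      ((rightDualTensorIso X X).inv)ᘁ ≫ (rightDualTensorIso (Xᘁ) (Xᘁ)).hom =
      (t * t) • c ≫ ((doubleDualIso X).hom ⊗ₘ (doubleDualIso X).hom) := by
    rw [Category.assoc, P.tensor, ht, MonoidalCategory.tensorHom_def,
      MonoidalCategory.tensorHom_def]
    simp [smul_smul]
  rw [hn, Category.assoc, doubleDualIso_tensor] at h2
  have h3 : c = (t * t) • c := by
    simpa [tensorHom_comp_tensorHom] using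
      h2 =≫ ((doubleDualIso X).inv ⊗ₘ (doubleDualIso X).inv)
  have h4 : (t * t - 1) • c = 0 := by rw [sub_smul, ← h3, one_smul, sub_self]
  exact sub_eq_zero.1 ((smul_eq_zero.1 h4).resolve_right hc)

/-- A trivalent vertex that is invariant under the rotation of a pivotal structure is invariant
under rotation by means of any pairing of `X` with itself. -/
theorem PivotalStructure.selfRotate_eq_self (P : PivotalStructure C) {X : C} [ExactPairing X X]
    (h1 : P.loop (𝟙_ C) = 𝟙 (𝟙_ C)) (hone : ∀ f : 𝟙_ C ⟶ 𝟙_ C, ∃ t : ℂ, f = t • 𝟙 (𝟙_ C))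
    (hX : ∀ f : X ⟶ X, ∃ t : ℂ, f = t • 𝟙 X) (hη : η_ X X ≠ 0) (y : X ⟶ X ⊗ X)
    (hrot : P.rotate (η_ X X ≫ X ◁ y) = η_ X X ≫ X ◁ y) (hbend : y ≫ bendLeft y ≠ 0) :
    selfRotate (η_ X X ≫ X ◁ y) = η_ X X ≫ X ◁ y := by
  have h10 : 𝟙 (𝟙_ C) ≠ 0 := fun h0 => hη (by
    rw [← Category.id_comp (η_ X X), h0, Limits.zero_comp])
  have hU := P.iso_eq_doubleDualIso (U := 𝟙_ C)
    (h1.trans (show _ = (ρ_ (𝟙_ C)).inv ≫ (ρ_ (𝟙_ C)).hom by simp)) (by rwa [h1]) hone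
  obtain ⟨t, ht⟩ := hX ((P.iso X).hom ≫ (doubleDualIso X).inv)
  rw [Iso.comp_inv_eq, Linear.smul_comp, Category.id_comp] at ht
  -- Here `c` is the coevaluation of `X` and `k` its evaluation, which are transposes of each other
  -- on both sides.
  have htt := P.indicator_sq hU ht hη (tensor_coevaluation_evaluation X)
    (coevaluation_tensor_evaluation X)
  have h2 : (doubleDualIso X).hom ≫ (P.iso X).inv = t • 𝟙 X := by
    rw [Iso.comp_inv_eq, Linear.smul_comp, Category.id_comp, ht, smul_smul, htt, one_smul]
  rw [P.rotate_eq, h2] at hrot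
  obtain ⟨s, hs⟩ := hX (y ≫ bendLeft y)
  have hs0 : s ≠ 0 := fun h0 => hbend (by rw [hs, h0, zero_smul])
  have h3 : t • selfRotate (η_ X X ≫ X ◁ y) = η_ X X ≫ X ◁ y := by simpa using hrot
  have h4 : selfRotate (η_ X X ≫ X ◁ y) = t • (η_ X X ≫ X ◁ y) := by
    conv_rhs => rw [← h3, smul_smul, htt, one_smul]
  -- On the left the two rotations contribute `t * t = 1`, leaving `s • η`. On the right one
  -- rotation is undone, leaving `(t * s) • η`.
  have h5 := selfRotate_selfRotate_bendLeft y
  have h6 : η_ X X ≫ X ◁ y ≫ (α_ X X X).inv ≫ bendLeft y ▷ X = (t * s) • η_ X X := by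
    have h7 := h3.symm =≫ ((α_ X X X).inv ≫ bendLeft y ▷ X)
    rw [selfRotate_rightTree] at h7
    simp only [Category.assoc, Linear.smul_comp, Iso.hom_inv_id_assoc,
      ← MonoidalCategory.comp_whiskerRight, hs] at h7
    rw [h7]
    simp [smul_smul]
  have h8 : selfRotate (selfRotate (η_ X X ≫ X ◁ y)) ≫ X ◁ bendLeft y = s • η_ X X := by
    rw [h4, selfRotate_smul, h3, Category.assoc, ← MonoidalCategory.whiskerLeft_comp, hs]
    simp
  rw [h6, h8] at h5
  have h9 : (s * (t - 1)) • η_ X X = 0 := by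
    rw [mul_sub, sub_smul, mul_one, mul_comm, ← h5, sub_self]
  have ht1 := (mul_eq_zero.1 ((smul_eq_zero.1 h9).resolve_right hη)).resolve_left hs0
  rw [h4, sub_eq_zero.1 ht1, one_smul]

end Indicator


/-! ### Fusion trees and the `F`-matrix -/

section Main

variable {C : Type u} [Category.{v} C] [Abelian C] [Linear ℂ C] [MonoidalCategory C]
  [MonoidalPreadditive C] [MonoidalLinear ℂ C] [RigidCategory C] [FusionCategory C]

theorem FusionCategory.exists_smul_id (X : C) [Simple X] (f : X ⟶ X) : ∃ t : ℂ, f = t • 𝟙 X := by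
  have := FusionCategory.finiteDimensional_hom X X
  obtain ⟨t, ht⟩ := endomorphism_simple_eq_smul_id ℂ f
  exact ⟨t, ht.symm⟩

attribute [local instance] Abelian.hasFiniteBiproducts in
theorem FusionCategory.exists_section {X Y : C} [Simple Y] {f : X ⟶ Y} (hf : f ≠ 0) :
    ∃ j : Y ⟶ X, j ≫ f = 𝟙 Y := by
  obtain ⟨n, S, hS, ⟨i⟩⟩ := FusionCategory.semisimple X
  have hne : i.inv ≫ f ≠ 0 := fun h0 => hf (by simpa using i.hom ≫= h0)
  obtain ⟨m, hm⟩ : ∃ m, Limits.biproduct.ι S m ≫ i.inv ≫ f ≠ 0 := by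
    by_contra! hcon
    exact hne (Limits.biproduct.hom_ext' _ _ fun m => by simpa using hcon m)
  have := hS m
  have := isIso_of_hom_simple hm
  refine ⟨inv (Limits.biproduct.ι S m ≫ i.inv ≫ f) ≫ Limits.biproduct.ι S m ≫ i.inv, ?_⟩
  have h1 := IsIso.inv_hom_id (Limits.biproduct.ι S m ≫ i.inv ≫ f)
  exact (by simp only [Category.assoc] : _ = _).trans h1

/-- Bending `c` gives `g : Xᘁ ⟶ X`, which has a section `j` by semisimplicity. Endomorphisms of `Xᘁ`
are scalars because their left mates are endomorphisms of the simple object `X`, so `g ≫ j = t • 𝟙`,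
and `j ≫ g = 𝟙` forces `t = 1`. -/
theorem FusionCategory.exists_exactPairing {X : C} [Simple X] {c : 𝟙_ C ⟶ X ⊗ X} (hc : c ≠ 0) :
    ∃ p : ExactPairing X X, η_ X X = c := by
  obtain ⟨g, hg⟩ : ∃ g : Xᘁ ⟶ X, η_ X Xᘁ ≫ X ◁ g = c := by
    refine ⟨(ρ_ _).inv ≫ (tensorLeftHomEquiv _ X Xᘁ X).symm c, ?_⟩
    apply (tensorLeftHomEquiv _ X Xᘁ X).symm.injective
    rw [tensorLeftHomEquiv_symm_coevaluation_comp_whiskerLeft]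
    simp
  have hg0 : g ≠ 0 := by
    rintro rfl
    exact hc (by simpa using hg.symm)
  obtain ⟨j, hj⟩ := FusionCategory.exists_section hg0
  obtain ⟨t, ht⟩ := FusionCategory.exists_smul_id X (ᘁ(g ≫ j))
  have h1 := coevaluation_comp_leftAdjointMate (g ≫ j)
  rw [ht] at h1
  have h2 : g ≫ j = t • 𝟙 (Xᘁ) := by
    apply whiskerLeft_coevaluation_injective (X := X)
    refine h1.symm.trans ?_
    simp
  have h3 : t • j = j := by
    have := j ≫= h2
    rw [reassoc_of% hj] at this
    simpa using this.symm
  have hj0 : j ≠ 0 := by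
    rintro rfl
    exact id_nonzero X (by simpa using hj.symm)
  have h4 : (t - 1) • j = 0 := by rw [sub_smul, h3, one_smul, sub_self]
  have ht1 := sub_eq_zero.1 ((smul_eq_zero.1 h4).resolve_right hj0)
  exact ⟨exactPairingCongrRight (Y' := Xᘁ) ⟨j, g, hj, by rw [h2, ht1, one_smul]⟩, hg⟩

namespace H3Category

variable {H : H3Category C} (e : H.Gauge)

/-- Resolve the identity of `a ⊗ b` through the basis vectors: by Schur's lemma `f` kills those with
label other than `k`, and multiplicity one leaves a single vector to detect `f`. -/
theorem Gauge.vec_comp_ne_zero {a b k : Label} {f : H.obj a ⊗ H.obj b ⟶ H.obj k} (hf : f ≠ 0) :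
    e.vec a b k ≫ f ≠ 0 := by
  intro h0
  obtain ⟨n, x, q, hx, hq⟩ := e.exists_resolution a b
  apply hf
  rw [← Category.id_comp f, hq, Preadditive.sum_comp]
  refine Finset.sum_eq_zero fun i _ => ?_
  rw [Category.assoc]
  suffices h : e.vec a b (x i) ≫ f = 0 by rw [h, Limits.comp_zero]
  by_cases hk : x i = k
  · rw [hk, h0]
  · by_contra hcon
    have := H.simple_obj
    have hi := isIso_of_hom_simple hcon
    exact (H.not_iso _ _ hk).false (@asIso _ _ _ _ _ hi)

theorem Gauge.leftTree_rho_rho_rho_one :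
    e.leftTree .rho .rho .rho .one .rho ≫ (α_ _ _ _).hom =
      e.rightTree .rho .rho .rho .one .rho := by
  have hs : Simple H.rho := H.simple_obj .rho
  have hs1 : Simple (𝟙_ C) := FusionCategory.simple_unit
  have hc : e.vec .rho .rho .one ≠ 0 := e.vec_ne_zero _ _ _ (by decide)
  obtain ⟨_, hp⟩ := FusionCategory.exists_exactPairing (X := H.rho) hc
  set y : H.rho ⟶ H.rho ⊗ H.rho := e.vec .rho .rho .rho
  have hR : e.rightTree .rho .rho .rho .one .rho = η_ H.rho H.rho ≫ H.rho ◁ y := by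
    rw [hp]; rfl
  have hL : e.leftTree .rho .rho .rho .one .rho ≫ (α_ _ _ _).hom = _ :=
    (Category.assoc _ _ _).trans ((congrArg (· ≫ y ▷ H.rho ≫ (α_ _ _ _).hom) hp.symm).trans
      (selfRotate_rightTree y).symm)
  rw [hL, hR]
  have hR0 : η_ H.rho H.rho ≫ H.rho ◁ y ≠ 0 := by
    rw [← hR]
    exact (e.rightTree_linearIndependent .rho .rho .rho .one).ne_zero ⟨.rho, by decide, by decide⟩
  -- The label `1` occurs in `ρ ⊗ j` only for `j = ρ`, so the right tree alone spans the space of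
  -- the vertex.
  have hv : ∃ t : ℂ, H.vertex = t • (η_ H.rho H.rho ≫ H.rho ◁ y) := by
    have hspan := e.rightTree_span .rho .rho .rho .one (Submodule.mem_top (x := H.vertex))
    have hrange : (Set.range fun j : RightLabel .rho .rho .rho .one =>
        e.rightTree .rho .rho .rho .one j) = {η_ H.rho H.rho ≫ H.rho ◁ y} := by
      rw [← hR]
      ext f
      constructor
      · rintro ⟨⟨j, hj⟩, rfl⟩
        have : j = .rho := by revert hj; revert j; decide
        subst this; rfl
      · rintro rfl
        exact ⟨⟨.rho, by decide, by decide⟩, rfl⟩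
    rw [hrange] at hspan
    obtain ⟨t, ht⟩ := Submodule.mem_span_singleton.1 hspan
    exact ⟨t, ht.symm⟩
  obtain ⟨t, ht⟩ := hv
  have ht0 : t ≠ 0 := by
    rintro rfl
    exact H.vertex_ne_zero (by rw [ht, zero_smul])
  refine H.pivotal.selfRotate_eq_self ?_ (FusionCategory.exists_smul_id _)
    (FusionCategory.exists_smul_id _) (hp ▸ hc) y ?_ ?_
  · simpa [simpleDim] using H.loop_eq .one
  · have h1 := H.rotate_vertex
    rw [ht, PivotalStructure.rotate_eq, selfRotate_smul, Linear.smul_comp,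
      ← PivotalStructure.rotate_eq] at h1
    exact smul_right_injective _ ht0 h1
  -- If `bendLeft y` vanished, unbending it would make the right tree vanish.
  · refine e.vec_comp_ne_zero (a := .rho) (b := .rho) (k := .rho) fun h0 => hR0 ?_
    have h1 := coevaluation_whiskerLeft_bendLeft y
    rw [h0] at h1
    simpa using (h1 =≫ (α_ _ _ _).hom).symm

theorem Gauge.UnitNormalized.vec_one_left {e : H.Gauge} (he : e.UnitNormalized) {x : Label}
    (hx : x = .one ∨ x = .rho) : e.vec .one x x = (λ_ (H.obj x)).inv :=
  (Iso.comp_hom_eq_id _).1 (he x hx).1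

theorem Gauge.UnitNormalized.vec_one_right {e : H.Gauge} (he : e.UnitNormalized) {x : Label}
    (hx : x = .one ∨ x = .rho) : e.vec x .one x = (ρ_ (H.obj x)).inv :=
  (Iso.comp_hom_eq_id _).1 (he x hx).2

theorem Gauge.UnitNormalized.leftTree_one_left {e : H.Gauge} (he : e.UnitNormalized)
    {b u : Label} (c : Label) (hb : b = .one ∨ b = .rho) (hu : u = .one ∨ u = .rho) :
    e.leftTree .one b c u b ≫ (α_ _ _ _).hom = e.rightTree .one b c u u := by
  rw [leftTree, rightTree, he.vec_one_left hb, he.vec_one_left hu]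
  simp

theorem Gauge.UnitNormalized.leftTree_one_middle {e : H.Gauge} (he : e.UnitNormalized)
    {a c : Label} (u : Label) (ha : a = .one ∨ a = .rho) (hc : c = .one ∨ c = .rho) :
    e.leftTree a .one c u a ≫ (α_ _ _ _).hom = e.rightTree a .one c u c := by
  rw [leftTree, rightTree, he.vec_one_right ha, he.vec_one_left hc]
  simp

theorem Gauge.UnitNormalized.leftTree_one_right {e : H.Gauge} (he : e.UnitNormalized)
    {b u : Label} (a : Label) (hb : b = .one ∨ b = .rho) (hu : u = .one ∨ u = .rho) :
    e.leftTree a b .one u u ≫ (α_ _ _ _).hom = e.rightTree a b .one u b := by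
  rw [leftTree, rightTree, he.vec_one_right hb, he.vec_one_right hu]
  simp

/-- If there is exactly one fusion tree in each bracketing and the associator sends one to the
other, then both spaces are one-dimensional and the `F`-matrix is `1`. -/
theorem Gauge.fMatrix_eq_one_of_unique {a b c u : Label} (j : RightLabel a b c u)
    (k : LeftLabel a b c u) (hj : ∀ j', j' = j) (hk : ∀ k', k' = k)
    (h : e.leftTree a b c u k ≫ (α_ _ _ _).hom = e.rightTree a b c u j) :
    Module.finrank ℂ (H.LeftSpace a b c u) = 1 ∧ Module.finrank ℂ (H.RightSpace a b c u) = 1 ∧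
      ∃ (j : RightLabel a b c u) (k : LeftLabel a b c u),
        (∀ j', j' = j) ∧ (∀ k', k' = k) ∧ e.FMatrix a b c u j k = 1 := by
  refine ⟨?_, ?_, j, k, hj, hk, ?_⟩
  · rw [Module.finrank_eq_card_basis (e.leftBasis a b c u)]
    exact Fintype.card_eq_one_iff.2 ⟨k, hk⟩
  · rw [Module.finrank_eq_card_basis (e.rightBasis a b c u)]
    exact Fintype.card_eq_one_iff.2 ⟨j, hj⟩
  · have h1 : H.FMap a b c u (e.leftBasis a b c u k) = e.rightBasis a b c u j := by
      rw [leftBasis, rightBasis, Module.Basis.mk_apply, Module.Basis.mk_apply]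
      exact h
    rw [FMatrix, LinearMap.toMatrix_apply, h1, Module.Basis.repr_self, Finsupp.single_eq_same]

end H3Category

end Main

end H3Fusion

theorem mainTheorem5 {C : Type*} [Category* C] [Abelian C] [Linear ℂ C] [MonoidalCategory C]
    [MonoidalPreadditive C] [MonoidalLinear ℂ C] [RigidCategory C] [H3Fusion.FusionCategory C]
    (H : H3Fusion.H3Category C) (e : H.Gauge) (he : e.UnitNormalized)
    (a b c u : H3Fusion.Label)
    (ha : a = .one ∨ a = .rho) (hb : b = .one ∨ b = .rho)
    (hc : c = .one ∨ c = .rho) (hu : u = .one ∨ u = .rho)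
    (hone : a = .one ∨ b = .one ∨ c = .one ∨ u = .one)
    (hallowed : H3Fusion.FusionAllowed a b c u) :
    Module.finrank ℂ (H.LeftSpace a b c u) = 1 ∧
    Module.finrank ℂ (H.RightSpace a b c u) = 1 ∧
    ∃ (j : H3Fusion.H3Category.RightLabel a b c u) (k : H3Fusion.H3Category.LeftLabel a b c u),
      (∀ j', j' = j) ∧ (∀ k', k' = k) ∧ e.FMatrix a b c u j k = 1 := by
  obtain ⟨k, hk, hku⟩ := hallowed
  rcases ha with rfl | rfl
  · obtain rfl : k = b := by simpa [H3Fusion.fuse] using hk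
    refine e.fMatrix_eq_one_of_unique ⟨u, hku, by simp [H3Fusion.fuse]⟩ ⟨k, hk, hku⟩ ?_ ?_
      (he.leftTree_one_left c hb hu)
    · rintro ⟨j, -, hj⟩
      exact Subtype.ext (by simpa [H3Fusion.fuse, eq_comm] using hj)
    · rintro ⟨j, hj, -⟩
      exact Subtype.ext (by simpa [H3Fusion.fuse] using hj)
  rcases hb with rfl | rfl
  · obtain rfl : k = .rho := by simpa [H3Fusion.fuse] using hk
    refine e.fMatrix_eq_one_of_unique ⟨c, by simp [H3Fusion.fuse], hku⟩ ⟨.rho, hk, hku⟩ ?_ ?_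
      (he.leftTree_one_middle u (.inr rfl) hc)
    · rintro ⟨j, hj, -⟩
      exact Subtype.ext (by simpa [H3Fusion.fuse] using hj)
    · rintro ⟨j, hj, -⟩
      exact Subtype.ext (by simpa [H3Fusion.fuse] using hj)
  rcases hc with rfl | rfl
  · have hr : ∀ x y : H3Fusion.Label, y ∈ H3Fusion.fuse x .one ↔ y = x := by decide
    obtain rfl : u = k := (hr k u).1 hku
    refine e.fMatrix_eq_one_of_unique ⟨.rho, by decide, hk⟩ ⟨u, hk, hku⟩ ?_ ?_
      (he.leftTree_one_right _ (.inr rfl) hu)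
    · rintro ⟨j, hj, -⟩
      exact Subtype.ext ((hr _ _).1 hj)
    · rintro ⟨j, -, hj⟩
      exact Subtype.ext ((hr _ _).1 hj).symm
  -- Only `a = b = c = ρ` remains, the one case that needs the trivalent vertex.
  obtain rfl : u = .one := by simpa using hone
  exact e.fMatrix_eq_one_of_unique ⟨.rho, by decide, by decide⟩ ⟨.rho, by decide, by decide⟩
    (by decide) (by decide) e.leftTree_rho_rho_rho_one
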